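/- Graphs are finite and undirected, without parallel edges; loops are allowed. For a graph $G$ on the vertex set $[n]=\{1,\dots,n\}$, the degree $\deg_G(i)$ of $i$ is the number of $j\in[n]$ such that $ij$ is an edge (so a loop counts once), and $d_G$ and $\Delta_G$ are the minimum and the maximum degree of $G$. The adjacency matrix $A_G$ has $(i,j)$ entry $1$ if $ij$ is an edge and $0$ otherwise, and the Laplacian is $\mathcal{L}_G = I_n - T_G A_G T_G$, where $T_G$ is the diagonal matrix whose $(i,i)$ entry is $\deg_G(i)^{-1/2}$ if $\deg_G(i)\neq 0$ and $0$ otherwise. For $p\in(0,1)$, bond percolation $G_p$ on $G$ is the random subgraph of $G$, on the same vertex set, that is obtained by retaining each edge of $G$ (loops included) independently with probability $p$. $\|\cdot\|$ is the spectral norm (the operator norm with respect to the Euclidean norm). Theorem. For every $c>0$ there exists $C=C(c)>0$ such that the following holds for all integers $n\ge 2$, all graphs $G$ on $[n]$ and all $p\in(0,1)$ with $p\,d_G\ge C\ln n$, and all $\delta$ with $n^{-c}\le\delta\le 1/2$: $$\mathbb{P}\left(\|A_{G_p}-pA_G\|\le 4\sqrt{p\,\Delta_G\,\ln(n/\delta)}\right)\ge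 1-\delta$$ and $$\mathbb{P}\left(\|\mathcal{L}_{G_p}-\mathcal{L}_G\|\le 14\sqrt{\frac{\ln(4n/\delta)}{p\,d_G}}\right)\ge 1-\delta.$$ -/

import Mathlib

open scoped Matrix.Norms.L2Operator

noncomputable section

/-- A graph on the vertex set `V`, in which loops are allowed and parallel edges are not. An edge is
an unordered pair `s(i, j)`, where `i = j` is possible (a loop). -/
@[ext]
structure LoopGraph (V : Type*) where
  edgeSet : Set (Sym2 V)

namespace LoopGraph

variable {V : Type*}

/-- The degree of `i`: the number of vertices `j` such that `ij` is an edge (so that a loop at `i`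
is counted once). -/
def degree (G : LoopGraph V) (i : V) : ℕ :=
  {j : V | s(i, j) ∈ G.edgeSet}.ncard

/-- The minimum degree of a graph on a nonempty finite vertex set. -/
def minDegree (G : LoopGraph V) : ℕ := ⨅ i, G.degree i

/-- The maximum degree of a graph on a nonempty finite vertex set. -/
def maxDegree (G : LoopGraph V) : ℕ := ⨆ i, G.degree i

open Classical in
/-- The adjacency matrix. -/
def adjMatrix (G : LoopGraph V) : Matrix V V ℝ :=
  Matrix.of fun i j => if s(i, j) ∈ G.edgeSet then 1 else 0

open Classical in
/-- The diagonal matrix with entries `degree i ^ (-1/2)`, and `0` where the degree is `0`. -/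
def invSqrtDegMatrix (G : LoopGraph V) : Matrix V V ℝ :=
  Matrix.diagonal fun i => if G.degree i = 0 then 0 else 1 / √(G.degree i : ℝ)

open Classical in
/-- The (normalized) Laplacian `I - T A T`. -/
def laplacian [Fintype V] (G : LoopGraph V) : Matrix V V ℝ :=
  1 - G.invSqrtDegMatrix * G.adjMatrix * G.invSqrtDegMatrix

open MeasureTheory ProbabilityTheory in
/-- The random graph `Gp`, defined on the probability space `(Ω, P)`, is bond percolation on `G` with
parameter `p`: it is a random subgraph of `G` (on the same vertex set) in which each edge of `G` is
present with probability `p`, independently of the other edges. -/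
structure IsBondPercolation {Ω : Type*} [MeasurableSpace Ω] (G : LoopGraph V) (p : ℝ)
    (P : Measure Ω) (Gp : Ω → LoopGraph V) : Prop where
  subset : ∀ ω, (Gp ω).edgeSet ⊆ G.edgeSet
  measurableSet : ∀ e ∈ G.edgeSet, MeasurableSet {ω | e ∈ (Gp ω).edgeSet}
  prob_eq : ∀ e ∈ G.edgeSet, P {ω | e ∈ (Gp ω).edgeSet} = ENNReal.ofReal p
  indep : iIndepSet (fun e : G.edgeSet => {ω | (e : Sym2 V) ∈ (Gp ω).edgeSet}) P

end LoopGraph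

end

/-! ### Trace inequalities for powers of symmetric matrices -/

namespace Matrix

variable {m : Type*} [Fintype m] [DecidableEq m]

/-! Both estimates are instances of a matrix Bernstein inequality for sums of independent centered
Bernoulli multiples of symmetric matrices, one summand per edge. Golden–Thompson and a scalar bound
applied to the spectrum show that adding a summand minus `p` times its square does not increase the
expected trace exponential (`trace_exp_add_bernoulli_le`). Induction over the edges, Markov's
inequality and the optimal scaling give the tail bound `sum_bernoulliWeight_lt_norm`.

The square of a single-edge matrix is diagonal, so the variance is controlled by degrees. Unit
weights give the adjacency estimate. For the Laplacian, the weights `1 / √(p * deg_G)` are used, and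
Bernstein is applied both to the weighted adjacency matrix and to the weighted degrees.
Deterministically, `norm_laplacian_sub_le` turns these two bounds into a Laplacian bound, because a
normalized adjacency matrix always has norm at most one. -/

theorem trace_mul_pow_comm (X Y : Matrix m m ℝ) (k : ℕ) :
    ((X * Y) ^ k).trace = ((Y * X) ^ k).trace := by
  cases k with
  | zero => simp
  | succ k =>
    have h : (X * Y) ^ (k + 1) = X * ((Y * X) ^ k * Y) := by
      induction k with
      | zero => simp
      | succ k ih => rw [pow_succ', ih, pow_succ' (Y * X)]; simp only [mul_assoc]
    rw [h, trace_mul_comm, mul_assoc, ← pow_succ]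

omit [DecidableEq m] in
theorem trace_conjTranspose_mul_self_nonneg (M : Matrix m m ℝ) : 0 ≤ (Mᴴ * M).trace :=
  (posSemidef_conjTranspose_mul_self M).trace_nonneg

/-- The AM–GM inequality for the Hilbert–Schmidt inner product: expand the squared norm of `P - Q`.
-/
theorem IsHermitian.two_mul_trace_mul_le {P Q : Matrix m m ℝ} (hP : P.IsHermitian)
    (hQ : Q.IsHermitian) : 2 * (P * Q).trace ≤ (P ^ 2).trace + (Q ^ 2).trace := by
  have h := trace_conjTranspose_mul_self_nonneg (P - Q)
  rw [conjTranspose_sub, hP.eq, hQ.eq, sub_mul, mul_sub, mul_sub, trace_sub, trace_sub, trace_sub,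
    trace_mul_comm Q P] at h
  rw [pow_two, pow_two]
  linarith

theorem abs_trace_sq_le (M : Matrix m m ℝ) : |(M ^ 2).trace| ≤ (Mᴴ * M).trace := by
  have h₁ := trace_conjTranspose_mul_self_nonneg (M - Mᴴ)
  have h₂ := trace_conjTranspose_mul_self_nonneg (M + Mᴴ)
  have h₃ : (Mᴴ * Mᴴ).trace = (M * M).trace := by
    rw [← conjTranspose_mul, trace_conjTranspose, star_trivial]
  simp only [conjTranspose_sub, conjTranspose_add, conjTranspose_conjTranspose, sub_mul, mul_sub,
    add_mul, mul_add, trace_sub, trace_add, h₃, trace_mul_comm M Mᴴ] at h₁ h₂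
  rw [pow_two, abs_le]
  constructor <;> linarith

/-- For exponents that are powers of two, the trace of a power of `M` is at most the corresponding
Schatten norm, and the trace of a power of a product of symmetric matrices is at most the trace of
the product of the powers. -/
theorem trace_two_pow_le (k : ℕ) :
    (∀ M : Matrix m m ℝ, |(M ^ 2 ^ (k + 1)).trace| ≤ ((Mᴴ * M) ^ 2 ^ k).trace) ∧
    ∀ P Q : Matrix m m ℝ, P.IsHermitian → Q.IsHermitian →
      ((P * Q) ^ 2 ^ k).trace ≤ (P ^ 2 ^ k * Q ^ 2 ^ k).trace := by
  induction k with
  | zero => exact ⟨fun M => by simpa using abs_trace_sq_le M, fun P Q _ _ => by simp⟩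
  | succ k ih =>
    -- The two claims feed each other: the first at `P * Q` reduces the second to the pair `P ^ 2`,
    -- `Q ^ 2`; the first for `M ^ 2`, followed by the second for `Mᴴ * M` and `M * Mᴴ`, gives the
    -- next case of the first.
    obtain ⟨ih₁, ih₂⟩ := ih
    have h₂ : ∀ P Q : Matrix m m ℝ, P.IsHermitian → Q.IsHermitian →
        ((P * Q) ^ 2 ^ (k + 1)).trace ≤ (P ^ 2 ^ (k + 1) * Q ^ 2 ^ (k + 1)).trace := by
      intro P Q hP hQ
      calc ((P * Q) ^ 2 ^ (k + 1)).trace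
          ≤ (((P * Q)ᴴ * (P * Q)) ^ 2 ^ k).trace := (le_abs_self _).trans (ih₁ _)
        _ = ((P ^ 2 * Q ^ 2) ^ 2 ^ k).trace := by
          rw [conjTranspose_mul, hP.eq, hQ.eq, mul_assoc, trace_mul_pow_comm]
          simp only [pow_two, mul_assoc]
        _ ≤ ((P ^ 2) ^ 2 ^ k * (Q ^ 2) ^ 2 ^ k).trace := ih₂ _ _ (hP.pow 2) (hQ.pow 2)
        _ = _ := by rw [← pow_mul, ← pow_mul, ← pow_succ']
    refine ⟨fun M => ?_, h₂⟩
    have hP : (Mᴴ * M).IsHermitian := isHermitian_conjTranspose_mul_self M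
    have hQ : (M * Mᴴ).IsHermitian := isHermitian_mul_conjTranspose_self M
    calc |(M ^ 2 ^ (k + 1 + 1)).trace| = |((M ^ 2) ^ 2 ^ (k + 1)).trace| := by
          rw [← pow_mul, ← pow_succ']
      _ ≤ (((M ^ 2)ᴴ * M ^ 2) ^ 2 ^ k).trace := ih₁ _
      _ = ((Mᴴ * M * (M * Mᴴ)) ^ 2 ^ k).trace := by
          rw [pow_two, conjTranspose_mul, mul_assoc, trace_mul_pow_comm]
          simp only [mul_assoc]
      _ ≤ ((Mᴴ * M) ^ 2 ^ k * (M * Mᴴ) ^ 2 ^ k).trace := ih₂ _ _ hP hQ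
      _ ≤ ((Mᴴ * M) ^ 2 ^ (k + 1)).trace := by
          have h := (hP.pow (2 ^ k)).two_mul_trace_mul_le (hQ.pow (2 ^ k))
          rw [← pow_mul, ← pow_mul, ← pow_succ, trace_mul_pow_comm M Mᴴ] at h
          linarith

end Matrix

/-! ### Lie product formula and Golden–Thompson inequality -/

open Filter Topology Asymptotics NormedSpace in
/-- The **Lie product formula**. -/
theorem tendsto_exp_mul_exp_pow {A : Type*} [NormedRing A] [NormedAlgebra ℝ A] [CompleteSpace A]
    [NormOneClass A] (a b : A) :
    Tendsto (fun N : ℕ => (exp ((N : ℝ)⁻¹ • a) * exp ((N : ℝ)⁻¹ • b)) ^ N) atTop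
      (𝓝 (exp (a + b))) := by
  let : NormedAlgebra ℚ A := NormedAlgebra.restrictScalars ℚ ℝ A
  have norm_exp_le : ∀ x : A, ‖exp x‖ ≤ Real.exp ‖x‖ := fun x => by
    have h₁ : HasSum (fun k : ℕ => ‖x‖ ^ k / (k.factorial : ℝ)) (Real.exp ‖x‖) := by
      rw [Real.exp_eq_exp_ℝ]
      exact expSeries_div_hasSum_exp ‖x‖
    rw [exp_eq_tsum ℝ]
    refine tsum_of_norm_bounded h₁ fun k => ?_
    rw [norm_smul, Real.norm_of_nonneg (by positivity), inv_mul_eq_div]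
    gcongr
    exact norm_pow_le _ _
  have pow_sub_pow_le : ∀ (x y : A) (r : ℝ), ‖x‖ ≤ r → ‖y‖ ≤ r → ∀ N : ℕ,
      ‖x ^ (N + 1) - y ^ (N + 1)‖ ≤ (N + 1) * r ^ N * ‖x - y‖ := by
    intro x y r hx hy N
    have hr : 0 ≤ r := (norm_nonneg x).trans hx
    induction N with
    | zero => simp
    | succ N ih =>
      have h : x ^ (N + 1 + 1) - y ^ (N + 1 + 1)
          = x * (x ^ (N + 1) - y ^ (N + 1)) + (x - y) * y ^ (N + 1) := by
        rw [pow_succ' x (N + 1), pow_succ' y (N + 1)]; noncomm_ring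
      rw [h]
      have h₁ : ‖x * (x ^ (N + 1) - y ^ (N + 1))‖ ≤ r * ((N + 1) * r ^ N * ‖x - y‖) :=
        (norm_mul_le _ _).trans (by gcongr)
      have h₂ : ‖(x - y) * y ^ (N + 1)‖ ≤ ‖x - y‖ * r ^ (N + 1) :=
        (norm_mul_le _ _).trans (by gcongr; exact (norm_pow_le _ _).trans (by gcongr))
      refine (norm_add_le _ _).trans ((add_le_add h₁ h₂).trans (le_of_eq ?_))
      push_cast
      ring
  have hd : ∀ x : A, HasDerivAt (fun t : ℝ => exp (t • x)) x 0 := fun x => by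
    simpa using hasDerivAt_exp_smul_const (𝕂 := ℝ) x (0 : ℝ)
  -- The one-step error is `o(1/N)`. Telescoping the `N`-th powers costs a factor `N` times a
  -- constant, so the total error vanishes.
  have hdiff : HasDerivAt (fun t : ℝ => exp (t • a) * exp (t • b) - exp (t • (a + b))) 0 0 := by
    have h := ((hd a).mul (hd b)).sub (hd (a + b))
    simp only [zero_smul, exp_zero, mul_one, one_mul, sub_self] at h
    exact h
  have hlim : Tendsto (fun N : ℕ => (N : ℝ) *
      ‖exp ((N : ℝ)⁻¹ • a) * exp ((N : ℝ)⁻¹ • b) - exp ((N : ℝ)⁻¹ • (a + b))‖) atTop (𝓝 0) := by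
    have h := hasDerivAt_iff_tendsto.1 hdiff
    have h' := h.comp (tendsto_inv_atTop_zero.comp (tendsto_natCast_atTop_atTop (R := ℝ)))
    simpa [Function.comp_def] using h'
  rw [tendsto_iff_norm_sub_tendsto_zero]
  have hlim' := hlim.const_mul (Real.exp (‖a‖ + ‖b‖))
  rw [mul_zero] at hlim'
  refine squeeze_zero' (Eventually.of_forall fun _ => norm_nonneg _) ?_ hlim'
  filter_upwards [eventually_gt_atTop 0] with N hN
  have hN' : (N : ℝ) ≠ 0 := by positivity
  have hsmul : ∀ x : A, ‖(N : ℝ)⁻¹ • x‖ = (N : ℝ)⁻¹ * ‖x‖ := fun x => by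
    rw [norm_smul, Real.norm_of_nonneg (by positivity)]
  have hexp : exp (a + b) = exp ((N : ℝ)⁻¹ • (a + b)) ^ N := by
    rw [← exp_nsmul, ← Nat.cast_smul_eq_nsmul ℝ, smul_smul, mul_inv_cancel₀ hN', one_smul]
  have hx : ‖exp ((N : ℝ)⁻¹ • a) * exp ((N : ℝ)⁻¹ • b)‖
      ≤ Real.exp ((N : ℝ)⁻¹ * (‖a‖ + ‖b‖)) := by
    rw [mul_add, Real.exp_add, ← hsmul, ← hsmul]
    exact (norm_mul_le _ _).trans (by gcongr <;> exact norm_exp_le _)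
  have hy : ‖exp ((N : ℝ)⁻¹ • (a + b))‖ ≤ Real.exp ((N : ℝ)⁻¹ * (‖a‖ + ‖b‖)) := by
    refine (norm_exp_le _).trans ?_
    rw [hsmul]
    gcongr
    exact norm_add_le _ _
  obtain ⟨k, rfl⟩ : ∃ k, N = k + 1 := ⟨N - 1, by omega⟩
  rw [hexp]
  refine (pow_sub_pow_le _ _ _ hx hy k).trans ?_
  have hr : Real.exp (((k + 1 : ℕ) : ℝ)⁻¹ * (‖a‖ + ‖b‖)) ^ k ≤ Real.exp (‖a‖ + ‖b‖) := by
    rw [← Real.exp_nat_mul, Real.exp_le_exp, ← mul_assoc]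
    refine mul_le_of_le_one_left (by positivity) ?_
    rw [mul_inv_le_iff₀ (by positivity), one_mul, Nat.cast_le]
    exact k.le_succ
  rw [← mul_assoc, mul_comm (Real.exp _), ← Nat.cast_succ]
  gcongr

namespace Matrix

variable {m : Type*} [Fintype m] [DecidableEq m]

open Filter Topology in
/-- The **Golden-Thompson inequality** for real symmetric matrices. -/
theorem IsHermitian.trace_exp_add_le {A B : Matrix m m ℝ} (hA : A.IsHermitian)
    (hB : B.IsHermitian) : (NormedSpace.exp (A + B)).trace ≤ (NormedSpace.exp A * NormedSpace.exp B).trace := by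
  cases isEmpty_or_nonempty m
  · simp [trace]
  have hpow : ∀ (X : Matrix m m ℝ) (k : ℕ), NormedSpace.exp (((2 ^ k : ℕ) : ℝ)⁻¹ • X) ^ 2 ^ k = NormedSpace.exp X := by
    intro X k
    rw [← Matrix.exp_nsmul, ← Nat.cast_smul_eq_nsmul ℝ, smul_smul, mul_inv_cancel₀ (by positivity),
      one_smul]
  have hherm : ∀ {X : Matrix m m ℝ} (r : ℝ), X.IsHermitian → (NormedSpace.exp (r • X)).IsHermitian :=
    fun r hX => IsHermitian.exp (by rw [IsHermitian, conjTranspose_smul, hX.eq, star_trivial])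
  -- The trace inequality is available for exponents `2 ^ k`, and this subsequence of the Lie
  -- formula suffices.
  have hlim := (tendsto_exp_mul_exp_pow A B).comp
    (tendsto_pow_atTop_atTop_of_one_lt (one_lt_two (α := ℕ)))
  have htr : Continuous fun X : Matrix m m ℝ => X.trace := continuous_id.matrix_trace
  refine le_of_tendsto ((htr.tendsto _).comp hlim) (Eventually.of_forall fun k => ?_)
  have h := (trace_two_pow_le k).2 _ _ (hherm ((2 ^ k : ℕ) : ℝ)⁻¹ hA) (hherm ((2 ^ k : ℕ) : ℝ)⁻¹ hB)
  rw [hpow, hpow] at h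
  exact h

end Matrix

/-! ### Trace exponentials and one Bernoulli summand -/

namespace Matrix

variable {m : Type*} [Fintype m] [DecidableEq m]

-- With `E` the exponential of `H / 2`, conjugating `1 - M` by `E` keeps it positive semidefinite,
-- so its trace is nonnegative.
open scoped MatrixOrder in
theorem IsHermitian.trace_exp_mul_le {H M : Matrix m m ℝ} (hH : H.IsHermitian) (hM : M ≤ 1) :
    (NormedSpace.exp H * M).trace ≤ (NormedSpace.exp H).trace := by
  set E := NormedSpace.exp ((2 : ℝ)⁻¹ • H) with hE
  have hEE : NormedSpace.exp H = E * E := by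
    rw [← pow_two, hE, ← Matrix.exp_nsmul, ← Nat.cast_smul_eq_nsmul ℝ, smul_smul]
    norm_num
  have hEh : Eᴴ = E :=
    (IsHermitian.exp (by rw [IsHermitian, conjTranspose_smul, hH.eq, star_trivial])).eq
  have h := ((le_iff.1 hM).conjTranspose_mul_mul_same E).trace_nonneg
  rw [hEh, mul_sub, sub_mul, mul_one, trace_sub, trace_mul_cycle E M E, ← hEE] at h
  linarith

theorem IsHermitian.abs_le_norm_of_mem_spectrum {A : Matrix m m ℝ} (hA : A.IsHermitian) {x : ℝ}
    (hx : x ∈ spectrum ℝ A) : |x| ≤ ‖A‖ := by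
  have h : ‖cfc (fun x : ℝ => x) A‖ ≤ ‖A‖ := by
    rw [cfc_id' ℝ A hA.isSelfAdjoint]
  exact (norm_cfc_le_iff (fun x : ℝ => x) A (norm_nonneg A) (by fun_prop) hA.isSelfAdjoint).1 h x hx

theorem IsHermitian.trace_exp_eq_sum {K : Matrix m m ℝ} (hK : K.IsHermitian) :
    (NormedSpace.exp K).trace = ∑ i, Real.exp (hK.eigenvalues i) := by
  rw [← CFC.real_exp_eq_normedSpace_exp hK.isSelfAdjoint, hK.cfc_eq, IsHermitian.cfc,
    Unitary.conjStarAlgAut_apply, trace_mul_cycle, Unitary.coe_star_mul_self, one_mul,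
    trace_diagonal]
  rfl

-- The exponential of each eigenvalue is one term of a sum of positive terms equal to the trace.
-- This links the Laplace transform to the Loewner order.
open scoped MatrixOrder in
theorem IsHermitian.le_smul_one_of_trace_exp_le {K : Matrix m m ℝ} (hK : K.IsHermitian) {r : ℝ}
    (h : (NormedSpace.exp K).trace ≤ Real.exp r) : K ≤ r • (1 : Matrix m m ℝ) := by
  rw [← Algebra.algebraMap_eq_smul_one]
  refine le_algebraMap_of_spectrum_le (fun x hx => ?_) hK.isSelfAdjoint
  rw [hK.spectrum_real_eq_range_eigenvalues] at hx
  obtain ⟨i, rfl⟩ := hx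
  rw [hK.trace_exp_eq_sum] at h
  rw [← Real.exp_le_exp]
  exact (Finset.single_le_sum (f := fun i => Real.exp (hK.eigenvalues i))
    (fun _ _ => (Real.exp_pos _).le) (Finset.mem_univ i)).trans h

open scoped MatrixOrder in
theorem IsHermitian.norm_le_of_le_of_neg_le {A : Matrix m m ℝ} (hA : A.IsHermitian) {t : ℝ}
    (ht : 0 ≤ t) (h₁ : A ≤ t • (1 : Matrix m m ℝ)) (h₂ : -A ≤ t • (1 : Matrix m m ℝ)) :
    ‖A‖ ≤ t := by
  rw [← Algebra.algebraMap_eq_smul_one] at h₁ h₂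
  rw [neg_le, ← map_neg] at h₂
  rw [← cfc_id' ℝ A hA.isSelfAdjoint]
  refine norm_cfc_le ht fun x hx => abs_le.2 ⟨?_, ?_⟩
  · exact (algebraMap_le_iff_le_spectrum hA.isSelfAdjoint).1 h₂ x hx
  · exact (le_algebraMap_iff_spectrum_le hA.isSelfAdjoint).1 h₁ x hx

/-- Use `exp y ≤ 1 + y + y ^ 2` for `|y| ≤ 1`: the linear terms cancel, the quadratic ones add up to
`p * (1 - p) * x ^ 2`, and `1 + p * x ^ 2 ≤ exp (p * x ^ 2)`. -/
theorem centered_bernoulli_exp_le_one {p x : ℝ} (hp₀ : 0 ≤ p) (hp₁ : p ≤ 1) (hx : |x| ≤ 1) :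
    p * Real.exp ((1 - p) * x - p * x ^ 2) + (1 - p) * Real.exp (-p * x - p * x ^ 2) ≤ 1 := by
  have key : ∀ r : ℝ, |r| ≤ 1 → Real.exp (r * x) ≤ 1 + r * x + (r * x) ^ 2 := fun r hr => by
    have h : |r * x| ≤ 1 := by
      rw [abs_mul]
      exact mul_le_one₀ hr (abs_nonneg _) hx
    linarith [(abs_le.1 (Real.abs_exp_sub_one_sub_id_le h)).2]
  have h₁ := key (1 - p) (abs_le.2 ⟨by linarith, by linarith⟩)
  have h₂ := key (-p) (abs_le.2 ⟨by linarith, by linarith⟩)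
  have h₃ : p * Real.exp ((1 - p) * x) + (1 - p) * Real.exp (-p * x) ≤ Real.exp (p * x ^ 2) := by
    have h := Real.add_one_le_exp (p * x ^ 2)
    have h₁' := mul_le_mul_of_nonneg_left h₁ hp₀
    have h₂' := mul_le_mul_of_nonneg_left h₂ (sub_nonneg.2 hp₁)
    nlinarith [mul_nonneg (mul_nonneg hp₀ hp₀) (sq_nonneg x)]
  rw [Real.exp_sub, Real.exp_sub, mul_div_assoc', mul_div_assoc', ← add_div]
  exact (div_le_one (Real.exp_pos _)).2 h₃

open scoped MatrixOrder in
/-- One summand of a sum of independent centered Bernoulli multiples of symmetric matrices,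
compensated by its variance, does not increase the expected trace exponential. -/
theorem trace_exp_add_bernoulli_le {p : ℝ} (hp₀ : 0 ≤ p) (hp₁ : p ≤ 1) {H B : Matrix m m ℝ}
    (hH : H.IsHermitian) (hB : B.IsHermitian) (hB₁ : ‖B‖ ≤ 1) :
    p * (NormedSpace.exp (H + ((1 - p) • B - p • B ^ 2))).trace +
      (1 - p) * (NormedSpace.exp (H + (-p • B - p • B ^ 2))).trace
      ≤ (NormedSpace.exp H).trace := by
  have hB' : IsSelfAdjoint B := hB.isSelfAdjoint
  have hcfc : ∀ r : ℝ, r • B - p • B ^ 2 = cfc (fun x : ℝ => r * x - p * x ^ 2) B := fun r => by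
    rw [cfc_sub _ _ B, cfc_const_mul_id r B, cfc_const_mul p _ B, cfc_pow_id B 2]
  have hexp : ∀ r : ℝ, NormedSpace.exp (r • B - p • B ^ 2)
      = cfc (fun x : ℝ => Real.exp (r * x - p * x ^ 2)) B := fun r => by
    rw [hcfc, ← CFC.real_exp_eq_normedSpace_exp (cfc_predicate _ B),
      ← cfc_comp Real.exp (fun x : ℝ => r * x - p * x ^ 2) B]
    rfl
  have hherm : ∀ r : ℝ, (r • B - p • B ^ 2).IsHermitian := fun r => by
    rw [hcfc]
    exact cfc_predicate _ B
  -- Both exponentials are functions of the single matrix `B`, so the scalar bound transfers through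
  -- the functional calculus.
  have hM : p • NormedSpace.exp ((1 - p) • B - p • B ^ 2)
      + (1 - p) • NormedSpace.exp (-p • B - p • B ^ 2) ≤ 1 := by
    rw [hexp, hexp, ← cfc_const_mul p _ B, ← cfc_const_mul (1 - p) _ B,
      ← cfc_add B (fun x => p * Real.exp ((1 - p) * x - p * x ^ 2))
        (fun x => (1 - p) * Real.exp (-p * x - p * x ^ 2))]
    exact cfc_le_one _ _ fun x hx => centered_bernoulli_exp_le_one hp₀ hp₁
      ((hB.abs_le_norm_of_mem_spectrum hx).trans hB₁)
  have h := hH.trace_exp_mul_le hM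
  rw [mul_add, mul_smul_comm, mul_smul_comm, trace_add, trace_smul, trace_smul, smul_eq_mul,
    smul_eq_mul] at h
  have h₁ := mul_le_mul_of_nonneg_left (hH.trace_exp_add_le (hherm (1 - p))) hp₀
  have h₂ := mul_le_mul_of_nonneg_left (hH.trace_exp_add_le (hherm (-p))) (sub_nonneg.2 hp₁)
  linarith

end Matrix

/-! ### Matrix Bernstein inequality for random subsets -/

open Classical in
/-- The probability that the random subset of `E` which contains each element of `E` independently
with probability `p` is equal to `S`. -/
noncomputable def bernoulliWeight {ι : Type*} (p : ℝ) (E S : Finset ι) : ℝ :=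
  ∏ e ∈ E, if e ∈ S then p else 1 - p

theorem bernoulliWeight_nonneg {ι : Type*} {p : ℝ} (hp₀ : 0 ≤ p) (hp₁ : p ≤ 1) (E S : Finset ι) :
    0 ≤ bernoulliWeight p E S :=
  Finset.prod_nonneg fun e _ => by split_ifs <;> linarith

-- Conditioning on whether `e` is chosen; independence enters the Bernstein argument in this form.
open Classical in
theorem sum_bernoulliWeight_insert {ι : Type*} (p : ℝ) {E : Finset ι} {e : ι} (he : e ∉ E)
    (f : Finset ι → ℝ) :
    ∑ S ∈ (insert e E).powerset, bernoulliWeight p (insert e E) S * f S =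
      ∑ S ∈ E.powerset, bernoulliWeight p E S * (p * f (insert e S) + (1 - p) * f S) := by
  rw [Finset.sum_powerset_insert he, ← Finset.sum_add_distrib]
  refine Finset.sum_congr rfl fun S hS => ?_
  have heS : e ∉ S := fun h => he (Finset.mem_powerset.1 hS h)
  have h : bernoulliWeight p E (insert e S) = bernoulliWeight p E S :=
    Finset.prod_congr rfl fun a ha => by
      have hae : a ≠ e := fun h => he (h ▸ ha)
      simp [hae]
  have h₁ : bernoulliWeight p (insert e E) (insert e S) = p * bernoulliWeight p E (insert e S) := by
    rw [bernoulliWeight, Finset.prod_insert he, if_pos (Finset.mem_insert_self e S)]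
    rfl
  have h₂ : bernoulliWeight p (insert e E) S = (1 - p) * bernoulliWeight p E S := by
    rw [bernoulliWeight, Finset.prod_insert he, if_neg heS]
    rfl
  rw [h₁, h₂, h]
  ring

namespace Matrix

variable {m ι : Type*} [Fintype m] [DecidableEq m]

open Classical in
/-- The sum over `e ∈ E` of the matrices `B e`, each multiplied by the centered indicator of
`e ∈ S`. -/
noncomputable def bernoulliSum (p : ℝ) (B : ι → Matrix m m ℝ) (E S : Finset ι) : Matrix m m ℝ :=
  ∑ e ∈ E, (if e ∈ S then 1 - p else -p) • B e

omit [Fintype m] [DecidableEq m] in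
theorem isHermitian_sum {s : Finset ι} {f : ι → Matrix m m ℝ} (h : ∀ e ∈ s, (f e).IsHermitian) :
    (∑ e ∈ s, f e).IsHermitian := by
  rw [IsHermitian, conjTranspose_sum]
  exact Finset.sum_congr rfl fun e he => (h e he).eq

omit [Fintype m] [DecidableEq m] in
theorem IsHermitian.smul_real {A : Matrix m m ℝ} (hA : A.IsHermitian) (r : ℝ) :
    (r • A).IsHermitian := by
  rw [IsHermitian, conjTranspose_smul, hA.eq, star_trivial]

omit [Fintype m] [DecidableEq m] in
theorem isHermitian_bernoulliSum {p : ℝ} {B : ι → Matrix m m ℝ} {E : Finset ι}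
    (hB : ∀ e ∈ E, (B e).IsHermitian) (S : Finset ι) : (bernoulliSum p B E S).IsHermitian :=
  isHermitian_sum fun e he => (hB e he).smul_real _

-- Each compensated summand makes the trace exponential a supermartingale, so elements of `E` can be
-- removed one at a time until only the trace of the identity is left.
open Classical in
theorem sum_bernoulliWeight_mul_trace_exp_le {p : ℝ} (hp₀ : 0 ≤ p) (hp₁ : p ≤ 1)
    (B : ι → Matrix m m ℝ) (E : Finset ι) (hB : ∀ e ∈ E, (B e).IsHermitian)
    (hB₁ : ∀ e ∈ E, ‖B e‖ ≤ 1) :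
    ∑ S ∈ E.powerset, bernoulliWeight p E S *
      (NormedSpace.exp (bernoulliSum p B E S - p • ∑ e ∈ E, B e ^ 2)).trace ≤ Fintype.card m := by
  induction E using Finset.induction_on with
  | empty => simp [bernoulliWeight, bernoulliSum]
  | insert a E ha ih =>
    rw [sum_bernoulliWeight_insert p ha]
    refine le_trans (Finset.sum_le_sum fun S hS => mul_le_mul_of_nonneg_left ?_
      (bernoulliWeight_nonneg hp₀ hp₁ E S)) (ih (fun e he => hB e (Finset.mem_insert_of_mem he))
        fun e he => hB₁ e (Finset.mem_insert_of_mem he))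
    have haS : a ∉ S := fun h => ha (Finset.mem_powerset.1 hS h)
    have hBE : ∀ e ∈ E, (B e).IsHermitian := fun e he => hB e (Finset.mem_insert_of_mem he)
    have hH : (bernoulliSum p B E S - p • ∑ e ∈ E, B e ^ 2).IsHermitian :=
      (isHermitian_bernoulliSum hBE S).sub
        ((isHermitian_sum fun e he => (hBE e he).pow 2).smul_real p)
    have h₁ : bernoulliSum p B (insert a E) (insert a S) = (1 - p) • B a + bernoulliSum p B E S := by
      rw [bernoulliSum, Finset.sum_insert ha, if_pos (Finset.mem_insert_self a S)]
      congr 1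
      refine Finset.sum_congr rfl fun e he => ?_
      have hea : e ≠ a := fun h => ha (h ▸ he)
      simp [hea]
    have h₂ : bernoulliSum p B (insert a E) S = -p • B a + bernoulliSum p B E S := by
      rw [bernoulliSum, Finset.sum_insert ha, if_neg haS]
      rfl
    have h := trace_exp_add_bernoulli_le hp₀ hp₁ hH (hB a (Finset.mem_insert_self a E))
      (hB₁ a (Finset.mem_insert_self a E))
    have hsplit : ∀ X Y Z W : Matrix m m ℝ, X + Y - (Z + W) = Y - W + (X - Z) :=
      fun X Y Z W => by abel
    rwa [h₁, h₂, Finset.sum_insert ha, smul_add, hsplit, hsplit]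

open scoped MatrixOrder in
open Classical in
/-- A one-sided matrix Bernstein inequality for sums of centered Bernoulli multiples. -/
theorem sum_bernoulliWeight_not_le {p R t v : ℝ} (hp₀ : 0 < p) (hp₁ : p ≤ 1) (ht : 0 < t)
    (hv : 0 < v) (hRt : R * t ≤ 2 * p * v) (B : ι → Matrix m m ℝ) (E : Finset ι)
    (hB : ∀ e ∈ E, (B e).IsHermitian) (hR : ∀ e ∈ E, ‖B e‖ ≤ R)
    (hvar : ∑ e ∈ E, B e ^ 2 ≤ v • (1 : Matrix m m ℝ)) :
    ∑ S ∈ E.powerset with ¬ bernoulliSum p B E S ≤ t • (1 : Matrix m m ℝ), bernoulliWeight p E S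
      ≤ Fintype.card m * Real.exp (-(t ^ 2 / (4 * p * v))) := by
  -- This `θ` maximizes `θ * t - p * θ ^ 2 * v`, with maximum `s`; `hRt` says exactly that `θ * R ≤
  -- 1`.
  set θ : ℝ := t / (2 * p * v) with hθ
  have hθ₀ : 0 < θ := by positivity
  set s : ℝ := t ^ 2 / (4 * p * v) with hs
  have hsum := sum_bernoulliWeight_mul_trace_exp_le hp₀.le hp₁ (fun e => θ • B e) E
    (fun e he => (hB e he).smul_real θ) fun e he => by
      rw [norm_smul, Real.norm_of_nonneg hθ₀.le]
      refine (mul_le_mul_of_nonneg_left (hR e he) hθ₀.le).trans ?_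
      rw [hθ, div_mul_eq_mul_div, div_le_one (by positivity), mul_comm]
      exact hRt
  have hscale : ∀ S, bernoulliSum p (fun e => θ • B e) E S = θ • bernoulliSum p B E S := fun S => by
    simp only [bernoulliSum, Finset.smul_sum, smul_comm θ]
  have hsq : ∑ e ∈ E, (θ • B e) ^ 2 = θ ^ 2 • ∑ e ∈ E, B e ^ 2 := by
    simp only [smul_pow, Finset.smul_sum]
  simp only [hscale, hsq] at hsum
  have hK : ∀ S, (θ • bernoulliSum p B E S - p • θ ^ 2 • ∑ e ∈ E, B e ^ 2).IsHermitian := fun S =>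
    ((isHermitian_bernoulliSum hB S).smul_real θ).sub
      (((isHermitian_sum fun e he => (hB e he).pow 2).smul_real _).smul_real p)
  have hlarge : ∀ S, ¬ bernoulliSum p B E S ≤ t • (1 : Matrix m m ℝ) → Real.exp s ≤
      (NormedSpace.exp (θ • bernoulliSum p B E S - p • θ ^ 2 • ∑ e ∈ E, B e ^ 2)).trace := by
    intro S hS
    by_contra! hlt
    refine hS ?_
    have h := (hK S).le_smul_one_of_trace_exp_le hlt.le
    have hvar' : p • θ ^ 2 • ∑ e ∈ E, B e ^ 2 ≤ p • θ ^ 2 • v • (1 : Matrix m m ℝ) := by gcongr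
    have h' : θ • bernoulliSum p B E S ≤ θ • t • (1 : Matrix m m ℝ) := by
      have h₃ := add_le_add h hvar'
      rw [sub_add_cancel] at h₃
      refine h₃.trans (le_of_eq ?_)
      rw [smul_smul, smul_smul, smul_smul, ← add_smul]
      congr 1
      rw [hs, hθ]
      field_simp
      ring
    have h₄ := smul_le_smul_of_nonneg_left h' (inv_nonneg.2 hθ₀.le)
    rwa [inv_smul_smul₀ hθ₀.ne', inv_smul_smul₀ hθ₀.ne'] at h₄
  -- Markov's inequality for the trace exponential.
  rw [Real.exp_neg, ← div_eq_mul_inv, le_div_iff₀ (Real.exp_pos s), Finset.sum_mul]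
  refine le_trans ?_ hsum
  refine (Finset.sum_le_sum fun S hS => mul_le_mul_of_nonneg_left
    (hlarge S (Finset.mem_filter.1 hS).2) (bernoulliWeight_nonneg hp₀.le hp₁ E S)).trans ?_
  refine Finset.sum_le_sum_of_subset_of_nonneg (Finset.filter_subset _ _) fun S _ _ =>
    mul_nonneg (bernoulliWeight_nonneg hp₀.le hp₁ E S) ?_
  rw [(hK S).trace_exp_eq_sum]
  exact Finset.sum_nonneg fun i _ => (Real.exp_pos _).le

open scoped MatrixOrder in
open Classical in
/-- A matrix Bernstein inequality for sums of centered Bernoulli multiples. -/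
theorem sum_bernoulliWeight_lt_norm {p R t v : ℝ} (hp₀ : 0 < p) (hp₁ : p ≤ 1) (ht : 0 < t)
    (hv : 0 < v) (hRt : R * t ≤ 2 * p * v) (B : ι → Matrix m m ℝ) (E : Finset ι)
    (hB : ∀ e ∈ E, (B e).IsHermitian) (hR : ∀ e ∈ E, ‖B e‖ ≤ R)
    (hvar : ∑ e ∈ E, B e ^ 2 ≤ v • (1 : Matrix m m ℝ)) :
    ∑ S ∈ E.powerset with t < ‖bernoulliSum p B E S‖, bernoulliWeight p E S
      ≤ 2 * Fintype.card m * Real.exp (-(t ^ 2 / (4 * p * v))) := by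
  have h₁ := sum_bernoulliWeight_not_le hp₀ hp₁ ht hv hRt B E hB hR hvar
  have h₂ := sum_bernoulliWeight_not_le hp₀ hp₁ ht hv hRt (-B) E (fun e he => (hB e he).neg)
    (fun e he => by simpa using hR e he) (by simpa using hvar)
  have hneg : ∀ S, bernoulliSum p (-B) E S = -bernoulliSum p B E S := fun S => by
    simp [bernoulliSum]
  simp only [hneg] at h₂
  refine le_trans ?_ ((add_le_add h₁ h₂).trans (le_of_eq (by ring)))
  rw [← Finset.sum_union_inter]
  refine le_add_of_le_of_nonneg (Finset.sum_le_sum_of_subset_of_nonneg ?_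
    fun S _ _ => bernoulliWeight_nonneg hp₀.le hp₁ E S)
    (Finset.sum_nonneg fun S _ => bernoulliWeight_nonneg hp₀.le hp₁ E S)
  intro S hS
  rw [Finset.mem_filter] at hS
  rw [← Finset.filter_or, Finset.mem_filter]
  refine ⟨hS.1, ?_⟩
  by_contra! h
  exact hS.2.not_ge ((isHermitian_bernoulliSum hB S).norm_le_of_le_of_neg_le ht.le h.1 h.2)

end Matrix

/-! ### From percolation to Bernoulli weights -/

namespace LoopGraph

variable {V : Type*}

-- The event is covered by finitely many values of the random edge set, each bounded through
-- independence. Monotonicity and subadditivity suffice, so `q` may be arbitrary and no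
-- measurability of the event is needed.
open MeasureTheory ProbabilityTheory in
open Classical in
theorem IsBondPercolation.measureReal_le {Ω : Type*} [MeasurableSpace Ω] {G : LoopGraph V} {p : ℝ}
    {P : Measure Ω} [IsProbabilityMeasure P] {Gp : Ω → LoopGraph V}
    (h : G.IsBondPercolation p P Gp) (hp₀ : 0 ≤ p) {E : Finset (Sym2 V)}
    (hE : (E : Set (Sym2 V)) = G.edgeSet) (q : LoopGraph V → Prop) :
    P.real {ω | q (Gp ω)} ≤ ∑ S ∈ E.powerset.filter fun S : Finset (Sym2 V) => q ⟨(S : Set (Sym2 V))⟩,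
      bernoulliWeight p E S := by
  have hmem : ∀ e : Sym2 V, e ∈ E ↔ e ∈ G.edgeSet := fun e => by rw [← hE, Finset.mem_coe]
  have : Fintype G.edgeSet := Fintype.subtype E hmem
  have hcover : {ω | q (Gp ω)} ⊆ ⋃ S ∈ E.powerset.filter fun S : Finset (Sym2 V) => q ⟨(S : Set (Sym2 V))⟩,
      {ω | (Gp ω).edgeSet = S} := by
    intro ω hω
    have hS : ((E.filter (· ∈ (Gp ω).edgeSet) : Finset (Sym2 V)) : Set (Sym2 V))
        = (Gp ω).edgeSet := by
      ext e
      simp only [Finset.coe_filter, Set.mem_ofPred_eq, hmem, and_iff_right_iff_imp]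
      exact fun he => h.subset ω he
    simp only [Set.mem_iUnion]
    refine ⟨E.filter (· ∈ (Gp ω).edgeSet), Finset.mem_filter.2
      ⟨Finset.mem_powerset.2 (Finset.filter_subset _ _), ?_⟩, hS.symm⟩
    rw [hS]
    exact hω
  refine (measureReal_mono hcover (measure_ne_top _ _)).trans ((measureReal_biUnion_finset_le _ _).trans
    (Finset.sum_le_sum fun S hS => ?_))
  -- Passing to generated σ-algebras makes independence available for absent edges as well.
  have hindep := (iIndepSet_iff_iIndep _ _).1 h.indep
  have hprob := hindep.meas_iInter (s := fun e : G.edgeSet =>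
    if (e : Sym2 V) ∈ S then {ω | (e : Sym2 V) ∈ (Gp ω).edgeSet}
      else {ω | (e : Sym2 V) ∈ (Gp ω).edgeSet}ᶜ) fun e => by
        have hm := MeasurableSpace.measurableSet_generateFrom
          (Set.mem_singleton {ω | (e : Sym2 V) ∈ (Gp ω).edgeSet})
        split_ifs
        · exact hm
        · exact hm.compl
  refine (measureReal_mono (s₂ := ⋂ e : G.edgeSet, if (e : Sym2 V) ∈ S
    then {ω | (e : Sym2 V) ∈ (Gp ω).edgeSet} else {ω | (e : Sym2 V) ∈ (Gp ω).edgeSet}ᶜ) ?_).trans ?_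
  · intro ω hω
    rw [Set.mem_ofPred_eq] at hω
    refine Set.mem_iInter.2 fun e => ?_
    split_ifs with he
    · simpa [hω] using he
    · simpa [hω] using he
  · rw [Measure.real, hprob, ENNReal.toReal_prod, bernoulliWeight]
    refine le_of_eq ?_
    rw [← Finset.prod_subtype E hmem fun e => (P (if e ∈ S then {ω | e ∈ (Gp ω).edgeSet}
      else {ω | e ∈ (Gp ω).edgeSet}ᶜ)).toReal]
    refine Finset.prod_congr rfl fun e he => ?_
    have he' := (hmem e).1 he
    split_ifs
    · rw [h.prob_eq e he', ENNReal.toReal_ofReal hp₀]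
    · rw [← Measure.real, probReal_compl_eq_one_sub (h.measurableSet e he'), Measure.real,
        h.prob_eq e he', ENNReal.toReal_ofReal hp₀]

/-! ### Single-edge matrices and their variances -/

section Matrices

variable [Fintype V] [DecidableEq V]

omit [DecidableEq V] in
open Classical in
theorem degree_eq_sum (G : LoopGraph V) (i : V) :
    (G.degree i : ℝ) = ∑ j, if s(i, j) ∈ G.edgeSet then (1 : ℝ) else 0 := by
  rw [degree, Set.ncard_eq_toFinset_card', Finset.sum_boole]
  congr 2
  ext j
  simp

omit [Fintype V] [DecidableEq V] in
theorem minDegree_le_degree (G : LoopGraph V) (i : V) : G.minDegree ≤ G.degree i :=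
  ciInf_le (OrderBot.bddBelow _) i

omit [DecidableEq V] in
theorem degree_le_maxDegree (G : LoopGraph V) (i : V) : G.degree i ≤ G.maxDegree :=
  le_ciSup (Set.finite_range _).bddAbove i

/-- The adjacency matrix of the graph with the single edge `e`, scaled by the vertex weights
`w`. -/
noncomputable def edgeMatrix (w : V → ℝ) (e : Sym2 V) : Matrix V V ℝ :=
  Matrix.of fun i j => if s(i, j) = e then w i * w j else 0

/-- The degree matrix of the graph with the single edge `e`, scaled by the vertex weights `w`. -/
noncomputable def edgeDegreeMatrix (w : V → ℝ) (e : Sym2 V) : Matrix V V ℝ :=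
  Matrix.diagonal fun i => w i ^ 2 * ∑ j, if s(i, j) = e then 1 else 0

omit [Fintype V] in
theorem isHermitian_edgeMatrix (w : V → ℝ) (e : Sym2 V) : (edgeMatrix w e).IsHermitian := by
  ext i j
  simp only [edgeMatrix, Matrix.conjTranspose_apply, Matrix.of_apply, star_trivial, Sym2.eq_swap,
    mul_comm]

theorem isHermitian_edgeDegreeMatrix (w : V → ℝ) (e : Sym2 V) :
    (edgeDegreeMatrix w e).IsHermitian :=
  Matrix.isHermitian_diagonal _

/-- A walk of length two along a single edge, loop or not, returns to its start, so nothing survives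
off the diagonal. -/
theorem edgeMatrix_sq (w : V → ℝ) (e : Sym2 V) : edgeMatrix w e ^ 2 =
    Matrix.diagonal fun i => w i ^ 2 * ∑ j, if s(i, j) = e then w j ^ 2 else 0 := by
  ext i k
  rw [pow_two, Matrix.mul_apply, Matrix.diagonal_apply]
  simp only [edgeMatrix, Matrix.of_apply]
  split_ifs with hik
  · subst hik
    rw [Finset.mul_sum]
    refine Finset.sum_congr rfl fun j _ => ?_
    rw [Sym2.eq_swap (a := j)]
    split_ifs
    · ring
    · ring
  · refine Finset.sum_eq_zero fun j _ => ?_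
    split_ifs with h₁ h₂
    · exact absurd (Sym2.congr_left.1 ((h₁.trans h₂.symm).trans Sym2.eq_swap)) hik
    all_goals simp

theorem edgeDegreeMatrix_sq (w : V → ℝ) (e : Sym2 V) : edgeDegreeMatrix w e ^ 2 =
    Matrix.diagonal fun i => w i ^ 2 * (w i ^ 2 * (∑ j, if s(i, j) = e then 1 else 0) ^ 2) := by
  rw [edgeDegreeMatrix, Matrix.diagonal_pow]
  congr 1
  ext i
  simp only [Pi.pow_apply]
  ring

/-- At most one `j` completes `i` to the edge `e`. -/
theorem sum_edge_eq_le (f : V → ℝ) {κ : ℝ} (hκ : 0 ≤ κ) (hf : ∀ j, f j ≤ κ) (i : V) (e : Sym2 V) :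
    (∑ j, if s(i, j) = e then f j else 0) ≤ κ := by
  by_cases h : ∃ j, s(i, j) = e
  · obtain ⟨j, rfl⟩ := h
    simp only [Sym2.congr_right, Finset.sum_ite_eq', Finset.mem_univ, if_true]
    exact hf j
  · push Not at h
    simpa [h] using hκ

theorem sum_edge_eq_nonneg (f : V → ℝ) (hf : ∀ j, 0 ≤ f j) (i : V) (e : Sym2 V) :
    0 ≤ ∑ j, if s(i, j) = e then f j else 0 :=
  Finset.sum_nonneg fun j _ => by split_ifs <;> simp [hf]

theorem norm_diagonal_le {f : V → ℝ} {κ : ℝ} (hκ : 0 ≤ κ) (h₀ : ∀ i, |f i| ≤ κ) :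
    ‖Matrix.diagonal f‖ ≤ κ := by
  rw [Matrix.l2_opNorm_diagonal]
  exact (pi_norm_le_iff_of_nonneg hκ).2 h₀

theorem norm_edgeMatrix_le {w : V → ℝ} {κ : ℝ} (hκ : ∀ i, w i ^ 2 ≤ κ) (hκ₀ : 0 ≤ κ)
    (e : Sym2 V) : ‖edgeMatrix w e‖ ≤ κ := by
  have h : ‖edgeMatrix w e‖ * ‖edgeMatrix w e‖ ≤ κ * κ := by
    rw [← Matrix.l2_opNorm_conjTranspose_mul_self, (isHermitian_edgeMatrix w e).eq, ← pow_two,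
      edgeMatrix_sq]
    refine norm_diagonal_le (by positivity) fun i => ?_
    have h₀ := sum_edge_eq_nonneg (fun j => w j ^ 2) (fun j => sq_nonneg _) i e
    rw [abs_of_nonneg (mul_nonneg (sq_nonneg _) h₀)]
    exact mul_le_mul (hκ i) (sum_edge_eq_le _ hκ₀ hκ i e) h₀ hκ₀
  exact abs_le_of_sq_le_sq' (by linarith [h]) hκ₀ |>.2

theorem norm_edgeDegreeMatrix_le {w : V → ℝ} {κ : ℝ} (hκ : ∀ i, w i ^ 2 ≤ κ) (hκ₀ : 0 ≤ κ)
    (e : Sym2 V) : ‖edgeDegreeMatrix w e‖ ≤ κ := by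
  refine norm_diagonal_le hκ₀ fun i => ?_
  have h₀ := sum_edge_eq_nonneg (fun _ => 1) (fun j => zero_le_one) i e
  rw [abs_of_nonneg (mul_nonneg (sq_nonneg _) h₀)]
  exact (mul_le_of_le_one_right (sq_nonneg _)
    (sum_edge_eq_le _ zero_le_one (fun _ => le_rfl) i e)).trans (hκ i)

omit [Fintype V] in
open scoped MatrixOrder in
theorem sum_diagonal_le {ι : Type*} (E : Finset ι) (f : ι → V → ℝ) {v : ℝ}
    (h : ∀ i, ∑ e ∈ E, f e i ≤ v) :
    ∑ e ∈ E, Matrix.diagonal (f e) ≤ v • (1 : Matrix V V ℝ) := by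
  have hsum : ∑ e ∈ E, Matrix.diagonal (f e) = Matrix.diagonal fun i => ∑ e ∈ E, f e i := by
    ext i j
    rw [Matrix.sum_apply]
    by_cases hij : i = j
    · simp [hij]
    · simp [hij]
  rw [hsum, Matrix.smul_one_eq_diagonal, Matrix.le_iff, Matrix.diagonal_sub,
    Matrix.posSemidef_diagonal_iff]
  exact fun i => sub_nonneg.2 (h i)

theorem sum_sum_edge_eq (G : LoopGraph V) {E : Finset (Sym2 V)}
    (hE : (E : Set (Sym2 V)) = G.edgeSet) (i : V) :
    (∑ e ∈ E, ∑ j, if s(i, j) = e then (1 : ℝ) else 0) = G.degree i := by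
  classical
  rw [degree_eq_sum, Finset.sum_comm]
  refine Finset.sum_congr rfl fun j _ => ?_
  rw [Finset.sum_ite_eq, ← hE]
  simp

-- The `i`-th diagonal entry is `w i ^ 2` times the sum of `w j ^ 2` over the neighbours `j`; bound
-- each of these by `κ` and count them by the degree.
open scoped MatrixOrder in
theorem sum_edgeMatrix_sq_le (G : LoopGraph V) {E : Finset (Sym2 V)}
    (hE : (E : Set (Sym2 V)) = G.edgeSet) {w : V → ℝ} {κ μ : ℝ} (hκ₀ : 0 ≤ κ)
    (hκ : ∀ i, w i ^ 2 ≤ κ) (hμ : ∀ i, w i ^ 2 * G.degree i ≤ μ) :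
    ∑ e ∈ E, edgeMatrix w e ^ 2 ≤ (κ * μ) • (1 : Matrix V V ℝ) := by
  simp only [edgeMatrix_sq]
  refine sum_diagonal_le E _ fun i => ?_
  calc (∑ e ∈ E, w i ^ 2 * ∑ j, if s(i, j) = e then w j ^ 2 else 0)
      ≤ ∑ e ∈ E, w i ^ 2 * ∑ j, if s(i, j) = e then κ else 0 := by
        gcongr with e _ j
        split_ifs
        · exact hκ j
        · exact le_rfl
    _ = κ * (w i ^ 2 * G.degree i) := by
        rw [← sum_sum_edge_eq G hE, ← Finset.mul_sum, mul_left_comm κ, Finset.mul_sum _ _ κ]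
        congr 1
        refine Finset.sum_congr rfl fun e _ => ?_
        rw [Finset.mul_sum]
        simp
    _ ≤ κ * μ := by gcongr; exact hμ i

open scoped MatrixOrder in
theorem sum_edgeDegreeMatrix_sq_le (G : LoopGraph V) {E : Finset (Sym2 V)}
    (hE : (E : Set (Sym2 V)) = G.edgeSet) {w : V → ℝ} {κ μ : ℝ} (hκ₀ : 0 ≤ κ)
    (hκ : ∀ i, w i ^ 2 ≤ κ) (hμ : ∀ i, w i ^ 2 * G.degree i ≤ μ) :
    ∑ e ∈ E, edgeDegreeMatrix w e ^ 2 ≤ (κ * μ) • (1 : Matrix V V ℝ) := by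
  simp only [edgeDegreeMatrix_sq]
  refine sum_diagonal_le E _ fun i => ?_
  -- The incidence count lies in `[0, 1]`, even for a loop, so squaring does not increase it.
  have hle : ∀ e, (∑ j, if s(i, j) = e then (1 : ℝ) else 0) ^ 2
      ≤ ∑ j, if s(i, j) = e then (1 : ℝ) else 0 := fun e =>
    pow_le_of_le_one (sum_edge_eq_nonneg _ (fun _ => zero_le_one) i e)
      (sum_edge_eq_le _ zero_le_one (fun _ => le_rfl) i e) two_ne_zero
  calc (∑ e ∈ E, w i ^ 2 * (w i ^ 2 * (∑ j, if s(i, j) = e then (1 : ℝ) else 0) ^ 2))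
      ≤ ∑ e ∈ E, κ * (w i ^ 2 * ∑ j, if s(i, j) = e then (1 : ℝ) else 0) := by
        refine Finset.sum_le_sum fun e _ => mul_le_mul (hκ i) ?_ (by positivity) hκ₀
        exact mul_le_mul_of_nonneg_left (hle e) (sq_nonneg _)
    _ = κ * (w i ^ 2 * G.degree i) := by
        rw [← sum_sum_edge_eq G hE, ← Finset.mul_sum, ← Finset.mul_sum]
    _ ≤ κ * μ := by gcongr; exact hμ i

omit [Fintype V] in
open Classical in
theorem bernoulliSum_eq (p : ℝ) (B : Sym2 V → Matrix V V ℝ) {E S : Finset (Sym2 V)} (hS : S ⊆ E) :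
    Matrix.bernoulliSum p B E S = ∑ e ∈ S, B e - p • ∑ e ∈ E, B e := by
  rw [← Finset.inter_eq_right.2 hS, ← Finset.sum_ite_mem, Finset.smul_sum, ← Finset.sum_sub_distrib,
    Matrix.bernoulliSum, Finset.inter_eq_right.2 hS]
  refine Finset.sum_congr rfl fun e _ => ?_
  split_ifs
  · rw [sub_smul, one_smul]
  · rw [zero_sub, neg_smul]

theorem sum_edgeMatrix (G : LoopGraph V) {E : Finset (Sym2 V)}
    (hE : (E : Set (Sym2 V)) = G.edgeSet) (w : V → ℝ) :
    ∑ e ∈ E, edgeMatrix w e = Matrix.diagonal w * G.adjMatrix * Matrix.diagonal w := by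
  ext i j
  rw [Matrix.sum_apply, Matrix.mul_diagonal, Matrix.diagonal_mul]
  simp only [edgeMatrix, adjMatrix, Matrix.of_apply, Finset.sum_ite_eq, ← hE, Finset.mem_coe]
  split_ifs <;> simp

theorem sum_edgeDegreeMatrix (G : LoopGraph V) {E : Finset (Sym2 V)}
    (hE : (E : Set (Sym2 V)) = G.edgeSet) (w : V → ℝ) :
    ∑ e ∈ E, edgeDegreeMatrix w e = Matrix.diagonal fun i => w i ^ 2 * G.degree i := by
  ext i j
  rw [Matrix.sum_apply]
  by_cases hij : i = j
  · subst hij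
    simp only [edgeDegreeMatrix, Matrix.diagonal_apply_eq]
    rw [← Finset.mul_sum, sum_sum_edge_eq G hE]
  · simp [edgeDegreeMatrix, hij]

end Matrices

end LoopGraph

namespace LoopGraph

variable {V : Type*} [Fintype V] [DecidableEq V]

/-! ### Tail bounds for weighted adjacency and degree matrices -/

section Tails

open MeasureTheory ProbabilityTheory

variable {Ω : Type*} [MeasurableSpace Ω] {G : LoopGraph V} {p : ℝ} {P : Measure Ω}
  [IsProbabilityMeasure P] {Gp : Ω → LoopGraph V}

open scoped MatrixOrder in
open Classical in
/-- Matrix Bernstein inequality for a random matrix that is additive over the edges of `Gp`. -/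
theorem IsBondPercolation.measureReal_lt_norm_sub_le (h : G.IsBondPercolation p P Gp)
    (hp₀ : 0 < p) (hp₁ : p ≤ 1) {B : Sym2 V → Matrix V V ℝ} {X : LoopGraph V → Matrix V V ℝ}
    (hX : ∀ (H : LoopGraph V) (S : Finset (Sym2 V)), (S : Set (Sym2 V)) = H.edgeSet →
      ∑ e ∈ S, B e = X H)
    (hB : ∀ e, (B e).IsHermitian) {R v t : ℝ} (hR : ∀ e, ‖B e‖ ≤ R)
    (hvar : ∀ E : Finset (Sym2 V), (E : Set (Sym2 V)) = G.edgeSet →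
      ∑ e ∈ E, B e ^ 2 ≤ v • (1 : Matrix V V ℝ))
    (ht : 0 < t) (hv : 0 < v) (hRt : R * t ≤ 2 * p * v) :
    P.real {ω | t < ‖X (Gp ω) - p • X G‖}
      ≤ 2 * Fintype.card V * Real.exp (-(t ^ 2 / (4 * p * v))) := by
  obtain ⟨E, hE⟩ := G.edgeSet.toFinite.exists_finset_coe
  refine (h.measureReal_le hp₀.le hE fun H => t < ‖X H - p • X G‖).trans ?_
  refine le_trans (le_of_eq ?_) (Matrix.sum_bernoulliWeight_lt_norm hp₀ hp₁ ht hv hRt B E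
    (fun e _ => hB e) (fun e _ => hR e) (hvar E hE))
  refine Finset.sum_congr (Finset.filter_congr fun S hS => ?_) fun _ _ => rfl
  rw [bernoulliSum_eq p B (Finset.mem_powerset.1 hS), hX G E hE, hX ⟨S⟩ S rfl]

/-- Bernstein with `R = κ` and `v = κ * μ`; the factor `κ` cancels from its range condition, leaving
`t ≤ 2 * p * μ`. -/
theorem IsBondPercolation.measureReal_lt_norm_adjMatrix_sub_le (h : G.IsBondPercolation p P Gp)
    (hp₀ : 0 < p) (hp₁ : p ≤ 1) {w : V → ℝ} {κ μ t : ℝ} (hκ₀ : 0 < κ) (hμ₀ : 0 < μ)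
    (hκ : ∀ i, w i ^ 2 ≤ κ) (hμ : ∀ i, w i ^ 2 * G.degree i ≤ μ) (ht : 0 < t)
    (htμ : t ≤ 2 * p * μ) :
    P.real {ω | t < ‖Matrix.diagonal w * (Gp ω).adjMatrix * Matrix.diagonal w -
        p • (Matrix.diagonal w * G.adjMatrix * Matrix.diagonal w)‖}
      ≤ 2 * Fintype.card V * Real.exp (-(t ^ 2 / (4 * p * (κ * μ)))) :=
  h.measureReal_lt_norm_sub_le hp₀ hp₁
    (X := fun H => Matrix.diagonal w * H.adjMatrix * Matrix.diagonal w)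
    (fun H _ hS => H.sum_edgeMatrix hS w) (isHermitian_edgeMatrix w)
    (norm_edgeMatrix_le hκ hκ₀.le) (fun _ hE => G.sum_edgeMatrix_sq_le hE hκ₀.le hκ hμ) ht
    (mul_pos hκ₀ hμ₀) ((mul_le_mul_of_nonneg_left htμ hκ₀.le).trans_eq (by ring))

theorem IsBondPercolation.measureReal_lt_norm_degree_sub_le (h : G.IsBondPercolation p P Gp)
    (hp₀ : 0 < p) (hp₁ : p ≤ 1) {w : V → ℝ} {κ μ t : ℝ} (hκ₀ : 0 < κ) (hμ₀ : 0 < μ)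
    (hκ : ∀ i, w i ^ 2 ≤ κ) (hμ : ∀ i, w i ^ 2 * G.degree i ≤ μ) (ht : 0 < t)
    (htμ : t ≤ 2 * p * μ) :
    P.real {ω | t < ‖(Matrix.diagonal fun i => w i ^ 2 * (Gp ω).degree i) -
        p • Matrix.diagonal fun i => w i ^ 2 * (G.degree i : ℝ)‖}
      ≤ 2 * Fintype.card V * Real.exp (-(t ^ 2 / (4 * p * (κ * μ)))) :=
  h.measureReal_lt_norm_sub_le hp₀ hp₁
    (X := fun H => Matrix.diagonal fun i => w i ^ 2 * (H.degree i : ℝ))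
    (fun H _ hS => H.sum_edgeDegreeMatrix hS w) (isHermitian_edgeDegreeMatrix w)
    (norm_edgeDegreeMatrix_le hκ hκ₀.le)
    (fun _ hE => G.sum_edgeDegreeMatrix_sq_le hE hκ₀.le hκ hμ) ht
    (mul_pos hκ₀ hμ₀) ((mul_le_mul_of_nonneg_left htμ hκ₀.le).trans_eq (by ring))

end Tails

/-! ### Deterministic comparison of Laplacians -/

omit [Fintype V] [DecidableEq V] in
theorem isHermitian_adjMatrix (G : LoopGraph V) : G.adjMatrix.IsHermitian := by
  ext i j
  simp only [adjMatrix, Matrix.conjTranspose_apply, Matrix.of_apply, star_trivial]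
  rw [Sym2.eq_swap]

omit [Fintype V] in
open Classical in
theorem invSqrtDegMatrix_eq (G : LoopGraph V) :
    G.invSqrtDegMatrix = Matrix.diagonal fun i => 1 / √(G.degree i : ℝ) := by
  ext i j
  simp only [invSqrtDegMatrix, Matrix.diagonal_apply]
  split_ifs with hij hi
  · simp [hi]
  · rfl
  · rfl

/-- Apply `2 * a * b ≤ a ^ 2 + b ^ 2` to each term of the quadratic form; normalization by the
degrees makes both resulting sums at most the squared length of `x`. The sign `s = ±1` in `key`
covers both sides. -/
theorem norm_normalized_adjMatrix_le_one (G : LoopGraph V) :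
    ‖G.invSqrtDegMatrix * G.adjMatrix * G.invSqrtDegMatrix‖ ≤ 1 := by
  classical
  set τ : V → ℝ := fun i => 1 / √(G.degree i : ℝ) with hτ
  rw [invSqrtDegMatrix_eq, ← hτ]
  set N := Matrix.diagonal τ * G.adjMatrix * Matrix.diagonal τ with hN
  have hNij : ∀ i j, N i j = τ i * G.adjMatrix i j * τ j := fun i j => by
    rw [hN, Matrix.mul_diagonal, Matrix.diagonal_mul]
  have hNh : N.IsHermitian := by
    ext i j
    rw [Matrix.conjTranspose_apply, star_trivial, hNij, hNij, ← G.isHermitian_adjMatrix.apply i j,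
      star_trivial]
    ring
  have hdeg : ∀ i, τ i ^ 2 * ∑ j, G.adjMatrix i j ≤ 1 := fun i => by
    have h : ∑ j, G.adjMatrix i j = (G.degree i : ℝ) := (G.degree_eq_sum i).symm
    rw [h, hτ, div_pow, Real.sq_sqrt (Nat.cast_nonneg _), one_pow, div_mul_eq_mul_div, one_mul]
    -- Isolated vertices are included, since `0 / 0 = 0`.
    exact div_self_le_one _
  have hA₀ : ∀ i j, 0 ≤ G.adjMatrix i j := fun i j => by
    simp only [adjMatrix, Matrix.of_apply]
    split_ifs <;> norm_num
  have hA₁ : ∀ i j, G.adjMatrix i j = G.adjMatrix j i := fun i j => by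
    rw [← G.isHermitian_adjMatrix.apply i j, star_trivial]
  have hrow : ∀ x : V → ℝ, ∑ i, ∑ j, G.adjMatrix i j * (τ i * x i) ^ 2 ≤ ∑ i, x i ^ 2 := by
    intro x
    refine Finset.sum_le_sum fun i _ => ?_
    rw [← Finset.sum_mul]
    have := mul_le_mul_of_nonneg_right (hdeg i) (sq_nonneg (x i))
    linarith
  have hcol : ∀ x : V → ℝ, ∑ i, ∑ j, G.adjMatrix i j * (τ j * x j) ^ 2 ≤ ∑ i, x i ^ 2 := by
    intro x
    rw [Finset.sum_comm]
    simp only [fun i j => hA₁ j i]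
    exact hrow x
  have key : ∀ s : ℝ, s ^ 2 = 1 → (1 - s • N).PosSemidef := by
    intro s hs
    refine .of_dotProduct_mulVec_nonneg (Matrix.isHermitian_one.sub (hNh.smul_real s)) fun x => ?_
    have hexp : star x ⬝ᵥ (1 - s • N).mulVec x
        = ∑ i, x i ^ 2 - ∑ i, ∑ j, s * (G.adjMatrix i j * ((τ i * x i) * (τ j * x j))) := by
      rw [Matrix.sub_mulVec, dotProduct_sub, Matrix.one_mulVec]
      congr 1
      · exact Finset.sum_congr rfl fun i _ => by simp [pow_two]
      · refine Finset.sum_congr rfl fun i _ => ?_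
        rw [Matrix.mulVec, dotProduct, Finset.mul_sum]
        refine Finset.sum_congr rfl fun j _ => ?_
        rw [Matrix.smul_apply, hNij, Pi.star_apply, star_trivial, smul_eq_mul]
        ring
    have hle : ∑ i, ∑ j, s * (G.adjMatrix i j * ((τ i * x i) * (τ j * x j))) ≤
        ∑ i, ∑ j, (G.adjMatrix i j * (τ i * x i) ^ 2 / 2 + G.adjMatrix i j * (τ j * x j) ^ 2 / 2) := by
      refine Finset.sum_le_sum fun i _ => Finset.sum_le_sum fun j _ => ?_
      have h := mul_nonneg (hA₀ i j) (sq_nonneg (s * (τ i * x i) - τ j * x j))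
      have h' : (s * (τ i * x i) - τ j * x j) ^ 2 = (τ i * x i) ^ 2 + (τ j * x j) ^ 2
          - 2 * (s * ((τ i * x i) * (τ j * x j))) := by
        linear_combination (τ i * x i) ^ 2 * hs
      rw [h'] at h
      linarith
    simp only [Finset.sum_add_distrib, ← Finset.sum_div] at hle
    rw [hexp]
    linarith [hrow x, hcol x]
  refine hNh.norm_le_of_le_of_neg_le zero_le_one ?_ ?_
  · simpa [Matrix.le_iff] using key 1 (by norm_num)
  · simpa [Matrix.le_iff] using key (-1) (by norm_num)

/-- If the degrees of `H` are close to `p` times the degrees of `G`, and the adjacency matrices are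
close after normalization, then the Laplacians are close. -/
theorem norm_laplacian_sub_le {G H : LoopGraph V} {p : ℝ} (hp : 0 < p)
    (hG : ∀ i, 0 < G.degree i) {w : V → ℝ} (hw : ∀ i, w i = 1 / √(p * G.degree i)) {ε : ℝ}
    (hε : ε ≤ 1)
    (hadj : ‖Matrix.diagonal w * H.adjMatrix * Matrix.diagonal w -
      p • (Matrix.diagonal w * G.adjMatrix * Matrix.diagonal w)‖ ≤ ε)
    (hdeg : ‖(Matrix.diagonal fun i => w i ^ 2 * (H.degree i : ℝ)) -
      p • Matrix.diagonal fun i => w i ^ 2 * (G.degree i : ℝ)‖ ≤ ε) :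
    ‖H.laplacian - G.laplacian‖ ≤ 4 * ε := by
  classical
  have hε₀ : 0 ≤ ε := (norm_nonneg _).trans hadj
  set N := H.invSqrtDegMatrix * H.adjMatrix * H.invSqrtDegMatrix with hN
  -- `D` has entries `√(deg_H / (p * deg_G))` and converts the normalization by the degrees of `H`
  -- into the one by `w`.
  set D : Matrix V V ℝ := Matrix.diagonal fun i => w i * √(H.degree i : ℝ) with hD
  have hw₀ : ∀ i, 0 ≤ w i := fun i => by rw [hw]; positivity
  have hdG : ∀ i, (0 : ℝ) < G.degree i := fun i => Nat.cast_pos.2 (hG i)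
  have hpG : p • (Matrix.diagonal w * G.adjMatrix * Matrix.diagonal w)
      = G.invSqrtDegMatrix * G.adjMatrix * G.invSqrtDegMatrix := by
    ext i j
    rw [invSqrtDegMatrix_eq, Matrix.smul_apply, Matrix.mul_diagonal, Matrix.diagonal_mul,
      Matrix.mul_diagonal, Matrix.diagonal_mul, hw, hw, smul_eq_mul, Real.sqrt_mul hp.le,
      Real.sqrt_mul hp.le]
    have h₁ := (Real.sqrt_pos.2 (hdG i)).ne'
    have h₂ := (Real.sqrt_pos.2 (hdG j)).ne'
    have h₃ := (Real.sqrt_pos.2 hp).ne'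
    field_simp
    rw [Real.sq_sqrt hp.le]
  have hDND : Matrix.diagonal w * H.adjMatrix * Matrix.diagonal w = D * N * D := by
    -- `D` vanishes at isolated vertices of `H`, but there the row of the adjacency matrix vanishes
    -- too.
    have hzero : ∀ i j, H.degree i = 0 → H.adjMatrix i j = 0 := fun i j hi => by
      have h := H.degree_eq_sum i
      rw [hi, Nat.cast_zero, eq_comm, Finset.sum_eq_zero_iff_of_nonneg
        fun j _ => by split_ifs <;> norm_num] at h
      exact h j (Finset.mem_univ j)
    ext i j
    rw [hN, hD, invSqrtDegMatrix_eq, Matrix.mul_diagonal, Matrix.diagonal_mul, Matrix.mul_diagonal,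
      Matrix.diagonal_mul, Matrix.mul_diagonal, Matrix.diagonal_mul]
    rcases Nat.eq_zero_or_pos (H.degree i) with hi | hi
    · simp [hzero i j hi]
    rcases Nat.eq_zero_or_pos (H.degree j) with hj | hj
    · have h := H.isHermitian_adjMatrix.apply i j
      rw [star_trivial, hzero j i hj] at h
      simp [← h]
    have h₁ := (Real.sqrt_pos.2 (Nat.cast_pos (α := ℝ).2 hi)).ne'
    have h₂ := (Real.sqrt_pos.2 (Nat.cast_pos (α := ℝ).2 hj)).ne'
    field_simp
  have hdiag : ∀ i, |w i ^ 2 * H.degree i - 1| ≤ ε := fun i => by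
    have h : (Matrix.diagonal fun i => w i ^ 2 * (H.degree i : ℝ)) -
        p • Matrix.diagonal (fun i => w i ^ 2 * (G.degree i : ℝ))
        = Matrix.diagonal fun i => w i ^ 2 * (H.degree i : ℝ) - 1 := by
      rw [← Matrix.diagonal_smul, Matrix.diagonal_sub]
      congr 1
      ext i
      rw [Pi.smul_apply, smul_eq_mul, hw, div_pow, Real.sq_sqrt (by positivity), one_pow]
      have := (hdG i).ne'
      field_simp
    rw [h, Matrix.l2_opNorm_diagonal] at hdeg
    exact (norm_le_pi_norm (fun i => w i ^ 2 * (H.degree i : ℝ) - 1) i).trans hdeg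
  -- For `x ≥ 0`, `|x - 1| ≤ |x ^ 2 - 1|`, so taking square roots of degree ratios loses nothing.
  have hD₁ : ‖D - 1‖ ≤ ε := by
    rw [hD, ← Matrix.diagonal_one, Matrix.diagonal_sub]
    refine norm_diagonal_le hε₀ fun i => le_trans ?_ (hdiag i)
    have hx : 0 ≤ w i * √(H.degree i : ℝ) := mul_nonneg (hw₀ i) (Real.sqrt_nonneg _)
    have h : w i ^ 2 * H.degree i - 1
        = (w i * √(H.degree i : ℝ) - 1) * (w i * √(H.degree i : ℝ) + 1) := by
      have := Real.sq_sqrt (Nat.cast_nonneg (α := ℝ) (H.degree i))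
      linear_combination -(w i) ^ 2 * this
    rw [h, abs_mul, abs_of_nonneg (by positivity : 0 ≤ w i * √(H.degree i : ℝ) + 1)]
    exact le_mul_of_one_le_right (abs_nonneg _) (by linarith)
  have hD₂ : ‖D‖ ≤ 2 := by
    have h : ‖(1 : Matrix V V ℝ)‖ ≤ 1 := by
      rw [← Matrix.diagonal_one]
      exact norm_diagonal_le zero_le_one fun i => by simp
    have h' := norm_add_le (D - 1) 1
    rw [sub_add_cancel] at h'
    linarith
  have hN₁ : ‖N‖ ≤ 1 := H.norm_normalized_adjMatrix_le_one
  -- The three pieces contribute `2 * ε`, `ε` and `ε`.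
  have hdecomp : H.laplacian - G.laplacian =
      ((D - 1) * N * D + N * (D - 1)) -
      (Matrix.diagonal w * H.adjMatrix * Matrix.diagonal w -
        p • (Matrix.diagonal w * G.adjMatrix * Matrix.diagonal w)) := by
    rw [hpG, hDND, laplacian, laplacian, ← hN]
    noncomm_ring
  have h₁ : ‖(D - 1) * N * D‖ ≤ ε * 1 * 2 :=
    (norm_mul_le _ _).trans (mul_le_mul ((norm_mul_le _ _).trans
      (mul_le_mul hD₁ hN₁ (norm_nonneg _) hε₀)) hD₂ (norm_nonneg _) (by positivity))
  have h₂ : ‖N * (D - 1)‖ ≤ 1 * ε :=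
    (norm_mul_le _ _).trans (mul_le_mul hN₁ hD₁ (norm_nonneg _) zero_le_one)
  rw [hdecomp]
  refine (norm_sub_le _ _).trans ?_
  linarith [norm_add_le ((D - 1) * N * D) (N * (D - 1))]

end LoopGraph

/-! ### Choice of parameters and conclusion -/

open MeasureTheory in
theorem one_sub_le_measureReal_of_compl {Ω : Type*} [MeasurableSpace Ω] {P : Measure Ω}
    [IsProbabilityMeasure P] {s t : Set Ω} {δ : ℝ} (h : ∀ ω, ω ∉ s → ω ∈ t) (ht : P.real t ≤ δ) :
    1 - δ ≤ P.real s := by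
  have h₁ := measureReal_union_le (μ := P) s t
  have h₂ : s ∪ t = Set.univ := by
    ext ω
    by_cases hω : ω ∈ s
    · simp [hω]
    · simp [h ω hω]
  rw [h₂, probReal_univ] at h₁
  linarith

namespace LoopGraph

open MeasureTheory in
theorem IsBondPercolation.adjMatrix_concentration {n : ℕ} (hn : 2 ≤ n) {G : LoopGraph (Fin n)}
    {p : ℝ} (hp₀ : 0 < p) (hp₁ : p ≤ 1) {Ω : Type*} [MeasurableSpace Ω] {P : Measure Ω}
    [IsProbabilityMeasure P] {Gp : Ω → LoopGraph (Fin n)} (h : G.IsBondPercolation p P Gp)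
    {δ : ℝ} (hδ₀ : 0 < δ) (hδ : δ ≤ 1 / 2) (hL : 4 * Real.log (n / δ) ≤ p * G.maxDegree) :
    1 - δ ≤ P.real {ω | ‖(Gp ω).adjMatrix - p • G.adjMatrix‖
      ≤ 4 * √(p * (G.maxDegree : ℝ) * Real.log (n / δ))} := by
  have hn₂ : (2 : ℝ) ≤ n := by exact_mod_cast hn
  set L := Real.log (n / δ) with hLdef
  have hδn : 1 < n / δ := by rw [lt_div_iff₀ hδ₀]; linarith
  have hL₀ : 0 < L := Real.log_pos hδn
  have hpΔ : 0 < p * (G.maxDegree : ℝ) := by linarith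
  have hΔ : (0 : ℝ) < G.maxDegree := pos_of_mul_pos_right hpΔ hp₀.le
  set t := 4 * √(p * (G.maxDegree : ℝ) * L) with ht
  have ht₀ : 0 < t := by positivity
  have htsq : t ^ 2 = 16 * (p * (G.maxDegree : ℝ) * L) := by
    rw [ht, mul_pow, Real.sq_sqrt (by positivity)]
    norm_num
  -- After squaring, this is exactly `hL`.
  have htμ : t ≤ 2 * p * G.maxDegree := by
    refine abs_le_of_sq_le_sq' ?_ (by positivity) |>.2
    rw [htsq]
    nlinarith
  have htail := h.measureReal_lt_norm_adjMatrix_sub_le hp₀ hp₁ (w := fun _ => 1) (κ := 1)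
    zero_lt_one hΔ (fun _ => by norm_num)
    (fun i => by simpa using G.degree_le_maxDegree i) ht₀ htμ
  refine one_sub_le_measureReal_of_compl (fun ω hω => ?_) (htail.trans ?_)
  · simpa using hω
  -- The tail is `2 * n * (δ / n) ^ 4`, well below `δ` because `δ / n ≤ 1 / 4`.
  · have hexp : t ^ 2 / (4 * p * (1 * (G.maxDegree : ℝ))) = (4 : ℕ) * L := by
      rw [htsq]
      field_simp
      norm_num
    rw [hexp, Real.exp_neg, Real.exp_nat_mul, hLdef, Real.exp_log (by linarith), Fintype.card_fin,
      ← inv_pow, inv_div]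
    have hx₀ : 0 < δ / n := by positivity
    have hx₁ : δ / n ≤ 1 / 4 := by
      rw [div_le_iff₀ (by linarith)]
      linarith
    have hx : (n : ℝ) * (δ / n) = δ := mul_div_cancel₀ _ (by linarith)
    have hx₃ : (δ / n) ^ 3 ≤ (1 / 4) ^ 3 := pow_le_pow_left₀ hx₀.le hx₁ 3
    calc 2 * (n : ℝ) * (δ / n) ^ 4 = 2 * (n * (δ / n)) * (δ / n) ^ 3 := by ring
      _ ≤ 2 * δ * (1 / 4) ^ 3 := by rw [hx]; gcongr
      _ ≤ δ := by linarith

open MeasureTheory in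
theorem IsBondPercolation.laplacian_concentration {n : ℕ} (hn : 2 ≤ n) {G : LoopGraph (Fin n)}
    {p : ℝ} (hp₀ : 0 < p) (hp₁ : p ≤ 1) {Ω : Type*} [MeasurableSpace Ω] {P : Measure Ω}
    [IsProbabilityMeasure P] {Gp : Ω → LoopGraph (Fin n)} (h : G.IsBondPercolation p P Gp)
    {δ : ℝ} (hδ₀ : 0 < δ) (hδ : δ ≤ 1 / 2) (hL : 4 * Real.log (4 * n / δ) ≤ p * G.minDegree) :
    1 - δ ≤ P.real {ω | ‖(Gp ω).laplacian - G.laplacian‖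
      ≤ 8 * √(Real.log (4 * n / δ) / (p * (G.minDegree : ℝ)))} := by
  have hn₂ : (2 : ℝ) ≤ n := by exact_mod_cast hn
  set L := Real.log (4 * n / δ) with hLdef
  have hδn : 1 < 4 * n / δ := by rw [lt_div_iff₀ hδ₀]; linarith
  have hL₀ : 0 < L := Real.log_pos hδn
  have hpd : 0 < p * (G.minDegree : ℝ) := by linarith
  have hd : (0 : ℝ) < G.minDegree := pos_of_mul_pos_right hpd hp₀.le
  have hdeg : ∀ i, (G.minDegree : ℝ) ≤ G.degree i := fun i =>
    Nat.cast_le.2 (G.minDegree_le_degree i)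
  have hdeg₀ : ∀ i, (0 : ℝ) < G.degree i := fun i => hd.trans_le (hdeg i)
  -- With `κ = 1 / (p * d)` and `μ = 1 / p`, where `d` is the minimum degree, the Bernstein exponent
  -- is exactly `L`, so each of the two tails is `δ / 2`. The hypothesis `hL` is equivalent to `t ≤
  -- 1`.
  set t := 2 * √(L / (p * (G.minDegree : ℝ))) with ht
  have ht₀ : 0 < t := by positivity
  have htsq : t ^ 2 = 4 * (L / (p * (G.minDegree : ℝ))) := by
    rw [ht, mul_pow, Real.sq_sqrt (by positivity)]
    norm_num
  have ht₁ : t ≤ 1 := by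
    refine abs_le_of_sq_le_sq' ?_ zero_le_one |>.2
    rw [htsq, mul_div_assoc', one_pow, div_le_one hpd]
    exact hL
  set w : Fin n → ℝ := fun i => 1 / √(p * G.degree i) with hw
  have hwsq : ∀ i, w i ^ 2 = 1 / (p * G.degree i) := fun i => by
    rw [hw, div_pow, Real.sq_sqrt (mul_pos hp₀ (hdeg₀ i)).le, one_pow]
  have hκ : ∀ i, w i ^ 2 ≤ 1 / (p * (G.minDegree : ℝ)) := fun i => by
    rw [hwsq]
    exact one_div_le_one_div_of_le hpd (mul_le_mul_of_nonneg_left (hdeg i) hp₀.le)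
  have hμ : ∀ i, w i ^ 2 * G.degree i ≤ 1 / p := fun i => by
    rw [hwsq]
    have := (hdeg₀ i).ne'
    exact le_of_eq (by field_simp)
  have htμ : t ≤ 2 * p * (1 / p) := by
    rw [mul_assoc, mul_one_div_cancel hp₀.ne']
    linarith
  have hprob : 2 * (Fintype.card (Fin n) : ℝ) *
      Real.exp (-(t ^ 2 / (4 * p * (1 / (p * (G.minDegree : ℝ)) * (1 / p))))) = δ / 2 := by
    have hexp : t ^ 2 / (4 * p * (1 / (p * (G.minDegree : ℝ)) * (1 / p))) = L := by
      rw [htsq]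
      field_simp
    rw [hexp, Real.exp_neg, hLdef, Real.exp_log (by linarith), Fintype.card_fin, inv_div]
    field_simp
    norm_num
  have htail₁ := h.measureReal_lt_norm_adjMatrix_sub_le hp₀ hp₁ (one_div_pos.2 hpd)
    (one_div_pos.2 hp₀) hκ hμ ht₀ htμ
  have htail₂ := h.measureReal_lt_norm_degree_sub_le hp₀ hp₁ (one_div_pos.2 hpd)
    (one_div_pos.2 hp₀) hκ hμ ht₀ htμ
  rw [hprob] at htail₁ htail₂
  refine one_sub_le_measureReal_of_compl (fun ω hω => ?_)
    ((measureReal_union_le _ _).trans ((add_le_add htail₁ htail₂).trans_eq (add_halves δ)))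
  by_contra hbad
  simp only [Set.mem_union, Set.mem_ofPred_eq, not_or, not_lt] at hbad
  refine hω ?_
  have hlap := norm_laplacian_sub_le hp₀ (fun i => Nat.cast_pos.1 (hdeg₀ i)) (fun i => rfl) ht₁
    hbad.1 hbad.2
  rw [Set.mem_ofPred_eq]
  linarith

end LoopGraph

theorem theorem7 (c : ℝ) (hc : 0 < c) :
    ∃ C : ℝ, 0 < C ∧
      ∀ (n : ℕ), 2 ≤ n →
      ∀ (G : LoopGraph (Fin n)) (p : ℝ), 0 < p → p < 1 →
      C * Real.log n ≤ p * (G.minDegree : ℝ) →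
      ∀ (Ω : Type*) [MeasurableSpace Ω] (P : MeasureTheory.Measure Ω)
        [MeasureTheory.IsProbabilityMeasure P] (Gp : Ω → LoopGraph (Fin n)),
      G.IsBondPercolation p P Gp →
      ∀ δ : ℝ, (n : ℝ) ^ (-c) ≤ δ → δ ≤ 1 / 2 →
        1 - δ ≤ P.real {ω | ‖(Gp ω).adjMatrix - p • G.adjMatrix‖
            ≤ 4 * √(p * (G.maxDegree : ℝ) * Real.log (n / δ))} ∧
        1 - δ ≤ P.real {ω | ‖(Gp ω).laplacian - G.laplacian‖
            ≤ 14 * √(Real.log (4 * n / δ) / (p * (G.minDegree : ℝ)))} := by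
  -- Since `n ≥ 2` and `δ ≥ n ^ (-c)`, the logarithm of `4 * n / δ` is at most `2 + 1 + c` times
  -- that of `n`; both estimates ask for a factor `4` more.
  refine ⟨4 * (3 + c), by linarith, ?_⟩
  intro n hn G p hp₀ hp₁ hC Ω _ P _ Gp h δ hδc hδ
  have hn₂ : (2 : ℝ) ≤ n := by exact_mod_cast hn
  have hn₀ : (0 : ℝ) < n := by linarith
  have hδ₀ : 0 < δ := (Real.rpow_pos_of_pos hn₀ _).trans_le hδc
  have hlog₂ : Real.log 2 ≤ Real.log n := Real.log_le_log two_pos hn₂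
  have hlog₄ : Real.log 4 ≤ 2 * Real.log n := by
    rw [show (4 : ℝ) = 2 ^ 2 by norm_num, Real.log_pow]
    push_cast
    linarith
  have hlogδ : -c * Real.log n ≤ Real.log δ := by
    rw [← Real.log_rpow hn₀]
    exact Real.log_le_log (Real.rpow_pos_of_pos hn₀ _) hδc
  have hL₁ : Real.log (4 * n / δ) ≤ (3 + c) * Real.log n := by
    rw [Real.log_div (by positivity) hδ₀.ne', Real.log_mul (by norm_num) hn₀.ne']
    linarith
  have hL₂ : Real.log (n / δ) ≤ Real.log (4 * n / δ) := by
    gcongr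
    linarith
  have hdΔ : (G.minDegree : ℝ) ≤ G.maxDegree :=
    Nat.cast_le.2 ((G.minDegree_le_degree ⟨0, by omega⟩).trans (G.degree_le_maxDegree _))
  have hpdΔ := mul_le_mul_of_nonneg_left hdΔ hp₀.le
  refine ⟨h.adjMatrix_concentration hn hp₀ hp₁.le hδ₀ hδ (by linarith),
    (h.laplacian_concentration hn hp₀ hp₁.le hδ₀ hδ (by linarith)).trans
      (MeasureTheory.measureReal_mono fun ω hω => ?_)⟩
  rw [Set.mem_ofPred_eq] at hω ⊢
  refine hω.trans ?_
  gcongr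
  norm_num
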